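/- For a group $F$ let $U_F$ be the free group with basis $\{u_g : g\in F,\ g\neq 1\}$, put $u_1=1$, and let $J_F$ be the kernel of the projection $U_F\to F$, $u_g\mapsto g$. For a normal subgroup $N$ of $F$ let $U_{N,F}$ be the kernel of the map $U_F\to U_{F/N}$, $u_g\mapsto u_{gN}$, let $J_{N,F}=U_{N,F}\cap J_F$, and let $$K^J_2(N,F)=\frac{J_{N,F}\cap[U_{N,F},U_F]}{[J_{N,F},U_F]\,[U_{N,F},J_F]},$$ which is an abelian group. Lemma 17. Let $C\subseteq B$ be a central subgroup of a group $B$, and write $B^{ab}=B/[B,B]$. Then there is a surjective homomorphism $$C\otimes_{\mathbb Z} B^{ab}\twoheadrightarrow K^J_2(C,B),\qquad c\otimes \bar b\mapsto \text{the class of } [u_c,u_b],$$ whose kernel is the subgroup generated by the elements $c\otimes\bar c$, $c\in C$, where $\bar b$ is the image of $b\in B$ in $B^{ab}$. Moreover $K^J_2(C,B)$ is an extension of $C\otimes_{\mathbb Z}(B/C)^{ab}$: there is a surjective homomorphism $K^J_2(C,B)\twoheadrightarrow C\otimes_{\mathbb Z}(B/C)^{ab}$ that sends the class of $[u_c,u_b]$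 to $c\otimes\overline{bC}$ for all $c\in C$, $b\in B$, where $\overline{bC}$ is the image of $bC$ in $(B/C)^{ab}$. -/

import Mathlib

open scoped TensorProduct commutatorElement

noncomputable section

namespace KJ

universe v w

/-- `U_F`: the free group with basis `u_g`, `g` a nontrivial element of the group `F`. -/
abbrev U (F : Type v) [Group F] : Type v := FreeGroup {g : F // g ≠ 1}

open Classical in
/-- The canonical element `u_g` of `U_F`, with the convention `u_1 = 1`. -/
def u {F : Type v} [Group F] (g : F) : U F :=
  if h : g = 1 then 1 else FreeGroup.of ⟨g, h⟩

/-- The canonical projection `U_F → F`, `u_g ↦ g`. -/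
def proj (F : Type v) [Group F] : U F →* F :=
  FreeGroup.lift fun g => (g : F)

/-- The homomorphism `U_F → U_G`, `u_g ↦ u_{f g}`, induced by a homomorphism `f : F → G`. -/
def mapU {F : Type v} {G : Type w} [Group F] [Group G] (f : F →* G) : U F →* U G :=
  FreeGroup.lift fun g => u (f (g : F))

@[simp]
theorem u_one {F : Type v} [Group F] : u (1 : F) = 1 := by
  simp [u]

@[simp]
theorem proj_u {F : Type v} [Group F] (g : F) : proj F (u g) = g := by
  by_cases h : g = 1
  · simp [h]
  · simp [u, h, proj]

@[simp]
theorem mapU_u {F : Type v} {G : Type w} [Group F] [Group G] (f : F →* G) (g : F) :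
    mapU f (u g) = u (f g) := by
  by_cases h : g = 1
  · simp [h]
  · simp [u, h, mapU]

variable {F : Type v} [Group F]

/-- `J_F`, the kernel of `U_F → F`. -/
def J (F : Type v) [Group F] : Subgroup (U F) := (proj F).ker

/-- `U_{N,F}`, the kernel of `U_F → U_{F/N}`. -/
def URel (N : Subgroup F) [N.Normal] : Subgroup (U F) := (mapU (QuotientGroup.mk' N)).ker

/-- `J_{N,F}`, the kernel of `U_{N,F} → N`, that is `U_{N,F} ∩ J_F`. -/
def JRel (N : Subgroup F) [N.Normal] : Subgroup (U F) := URel N ⊓ J F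

/-- `J_{N,F} ∩ [U_{N,F}, U_F]`. -/
def cycles (N : Subgroup F) [N.Normal] : Subgroup (U F) :=
  JRel N ⊓ ⁅URel N, (⊤ : Subgroup (U F))⁆

/-- `[J_{N,F}, U_F] + [U_{N,F}, J_F]`. -/
def boundaries (N : Subgroup F) [N.Normal] : Subgroup (U F) :=
  ⁅JRel N, (⊤ : Subgroup (U F))⁆ ⊔ ⁅URel N, J F⁆

instance normal_J : (J F).Normal := by unfold J; infer_instance

instance normal_URel (N : Subgroup F) [N.Normal] : (URel N).Normal := by
  unfold URel; infer_instance

instance normal_JRel (N : Subgroup F) [N.Normal] : (JRel N).Normal := by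
  unfold JRel; infer_instance

instance normal_boundaries (N : Subgroup F) [N.Normal] : (boundaries N).Normal := by
  unfold boundaries; infer_instance

/-- The subgroup divided out below is all of `boundaries N`. -/
theorem boundaries_le_cycles (N : Subgroup F) [N.Normal] : boundaries N ≤ cycles N := by
  refine sup_le (le_inf ?_ ?_) (le_inf (le_inf ?_ ?_) ?_)
  · exact Subgroup.commutator_le_left _ _
  · exact Subgroup.commutator_mono inf_le_left le_rfl
  · exact Subgroup.commutator_le_left _ _
  · exact Subgroup.commutator_le_right _ _
  · exact Subgroup.commutator_mono le_rfl le_top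

/-- `K^J_2(N, F) = (J_{N,F} ∩ [U_{N,F}, U_F]) / ([J_{N,F}, U_F] + [U_{N,F}, J_F])`. -/
abbrev K2 (N : Subgroup F) [N.Normal] : Type v :=
  cycles N ⧸ (boundaries N).subgroupOf (cycles N)

instance commGroup_K2 (N : Subgroup F) [N.Normal] : CommGroup (K2 N) :=
  { (inferInstance : Group (K2 N)) with
    mul_comm := by
      intro a b
      obtain ⟨x, rfl⟩ := QuotientGroup.mk_surjective a
      obtain ⟨y, rfl⟩ := QuotientGroup.mk_surjective b
      have h : ⁅y⁻¹, x⁻¹⁆ ∈ (boundaries N).subgroupOf (cycles N) :=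
        Subgroup.mem_subgroupOf.2 (Subgroup.mem_sup_left
          (Subgroup.commutator_mem_commutator (y⁻¹).2.1 (Subgroup.mem_top _)))
      refine QuotientGroup.eq.2 ?_
      simpa [commutatorElement_def, mul_assoc] using h }

/-- A central subgroup is normal. -/
theorem normal_of_central {C : Subgroup F} (hC : C ≤ Subgroup.center F) : C.Normal :=
  ⟨fun c hc g => by
    rw [Subgroup.mem_center_iff.1 (hC hc) g, mul_inv_cancel_right]; exact hc⟩

/-- A central subgroup is an abelian group (with its subgroup structure). -/
abbrev commGroupOfCentral {C : Subgroup F} (hC : C ≤ Subgroup.center F) : CommGroup C :=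
  { (inferInstance : Group C) with
    mul_comm := fun a b => Subtype.ext (Subgroup.mem_center_iff.1 (hC b.2) a) }

theorem commutator_mem_cycles {C : Subgroup F} [C.Normal] (hC : C ≤ Subgroup.center F)
    (c : C) (b : F) : ⁅u (c : F), u b⁆ ∈ cycles C := by
  have hc : u (c : F) ∈ URel C := by
    have h : (QuotientGroup.mk' C) (c : F) = 1 := (QuotientGroup.eq_one_iff _).2 c.2
    rw [URel, MonoidHom.mem_ker, mapU_u, h, u_one]
  have h1 : ⁅u (c : F), u b⁆ ∈ ⁅URel C, (⊤ : Subgroup (U F))⁆ :=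
    Subgroup.commutator_mem_commutator hc (Subgroup.mem_top _)
  refine ⟨⟨Subgroup.commutator_le_left _ _ h1, ?_⟩, h1⟩
  change proj F _ = 1
  rw [map_commutatorElement, proj_u, proj_u, commutatorElement_eq_one_iff_mul_comm]
  exact (Subgroup.mem_center_iff.1 (hC c.2) b).symm

/-- For a central subgroup `C` of `F`, the class of `[u_c, u_b]` in `K^J_2(C, F)`. -/
def symbol {C : Subgroup F} [C.Normal] (hC : C ≤ Subgroup.center F) (c : C) (b : F) : K2 C :=
  QuotientGroup.mk (⟨⁅u (c : F), u b⁆, commutator_mem_cycles hC c b⟩ : cycles C)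

end KJ

end

open scoped TensorProduct commutatorElement

namespace KJ

/-! Modulo boundaries, `⁅v, x⁆` with `v ∈ URel C` depends only on the images of `v` and `x` in `B`
(`mk_commutator_congr`). Hence symbols are biadditive, generate `K2 C`, and vanish on `(c, c)`,
which gives the surjection. The substance is the upper bound on its kernel: every biadditive `t` on
`C × B^ab` with `t(c, c) = 0` must factor through `K2 C` (`exists_hom_of_alternating`). As `U B` is
free, it maps to a Heisenberg group whose commutators compute `t` on `URel C`; the central
coordinate is then the required map on cycles. Taking the universal such `t` determines the kernel,
and taking `t` with values in `C ⊗ (B/C)^ab` gives the second surjection. -/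

/-! ### Heisenberg extensions and antisymmetrization. -/

/-- The central extension of the additive group `L` by `A` with cocycle the biadditive map `γ`. -/
@[ext]
structure Heis {L A : Type*} [AddCommGroup L] [AddCommGroup A] (γ : L →+ L →+ A) where
  base : L
  fib : A

namespace Heis

variable {L A : Type*} [AddCommGroup L] [AddCommGroup A] {γ : L →+ L →+ A}

instance : Mul (Heis γ) := ⟨fun x y => ⟨x.base + y.base, x.fib + y.fib + γ x.base y.base⟩⟩
instance : One (Heis γ) := ⟨⟨0, 0⟩⟩
instance : Inv (Heis γ) := ⟨fun x => ⟨-x.base, -x.fib + γ x.base x.base⟩⟩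

@[simp] theorem mul_base (x y : Heis γ) : (x * y).base = x.base + y.base := rfl
@[simp] theorem mul_fib (x y : Heis γ) : (x * y).fib = x.fib + y.fib + γ x.base y.base := rfl
@[simp] theorem one_base : (1 : Heis γ).base = 0 := rfl
@[simp] theorem one_fib : (1 : Heis γ).fib = 0 := rfl
@[simp] theorem inv_base (x : Heis γ) : (x⁻¹).base = -x.base := rfl
@[simp] theorem inv_fib (x : Heis γ) : (x⁻¹).fib = -x.fib + γ x.base x.base := rfl

instance : Group (Heis γ) :=
  Group.ofLeftAxioms
    (fun x y z => by
      ext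
      · simp [add_assoc]
      · simp only [mul_fib, mul_base, map_add, AddMonoidHom.add_apply]; abel)
    (fun x => by ext <;> simp)
    (fun x => by ext <;> simp)

theorem commutator_eq (x y : Heis γ) :
    ⁅x, y⁆ = ⟨0, γ x.base y.base - γ y.base x.base⟩ := by
  rw [commutatorElement_def, mul_inv_eq_iff_eq_mul, mul_inv_eq_iff_eq_mul]
  ext
  · simp [add_comm]
  · simp only [mul_fib, mul_base, map_zero, AddMonoidHom.zero_apply, zero_add]; abel

/-- The projection of a Heisenberg extension to its base. -/
def baseHom (γ : L →+ L →+ A) : Heis γ →* Multiplicative L where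
  toFun x := Multiplicative.ofAdd x.base
  map_one' := rfl
  map_mul' _ _ := rfl

end Heis

/-- An alternating biadditive map, pulled back to a free abelian group, is the
antisymmetrization of a biadditive map. -/
theorem exists_sub_flip_eq {D A : Type*} [AddCommGroup D] [AddCommGroup A]
    (t : D →+ D →+ A) (ht : ∀ d, t d d = 0) :
    ∃ β : FreeAbelianGroup D →+ FreeAbelianGroup D →+ A, ∀ x y,
      β x y - β y x = t (FreeAbelianGroup.lift id x) (FreeAbelianGroup.lift id y) := by
  classical
  have hanti : ∀ a b, t a b = -t b a := fun a b => by
    have h := ht (a + b)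
    simp only [map_add, AddMonoidHom.add_apply, ht, zero_add, add_zero] at h
    exact eq_neg_of_add_eq_zero_right h
  -- The strictly upper triangular part of `t` for a well-order on the basis; such a choice is
  -- possible only after passing to a free group.
  let β : FreeAbelianGroup D →+ FreeAbelianGroup D →+ A :=
    FreeAbelianGroup.lift fun a => FreeAbelianGroup.lift fun b =>
      if WellOrderingRel a b then t a b else 0
  refine ⟨β, fun x y => ?_⟩
  let p : FreeAbelianGroup D →+ D := FreeAbelianGroup.lift id
  have h : β - β.flip = ((t.comp p).flip.comp p).flip := by
    ext a b
    simp only [AddMonoidHom.sub_apply, AddMonoidHom.flip_apply, β, p, AddMonoidHom.comp_apply,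
      FreeAbelianGroup.lift_apply_of, id]
    rcases trichotomous_of WellOrderingRel a b with h | h | h
    · simp [h, asymm_of WellOrderingRel h]
    · subst h; simp [ht]
    · simp [h, asymm_of WellOrderingRel h, hanti a b]
  exact DFunLike.congr_fun (DFunLike.congr_fun h x) y

/-! ### Commutators modulo boundaries and the calculus of symbols. -/

variable {B : Type*} [Group B]

theorem monoidHom_ext_u {G : Type*} [Monoid G] {f g : U B →* G} (h : ∀ b, f (u b) = g (u b)) :
    f = g := by
  ext b
  simpa [u, b.2] using h b

theorem abelianization_of_surjective (G : Type*) [Group G] :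
    Function.Surjective (Abelianization.of : G →* Abelianization G) :=
  QuotientGroup.mk_surjective

theorem mem_URel_of_mem {C : Subgroup B} [C.Normal] {c : B} (hc : c ∈ C) : u c ∈ URel C := by
  have h : (QuotientGroup.mk' C) c = 1 := (QuotientGroup.eq_one_iff _).2 hc
  rw [URel, MonoidHom.mem_ker, mapU_u, h, u_one]

theorem mk_proj {C : Subgroup B} [C.Normal] (x : U B) :
    (QuotientGroup.mk' C) (proj B x) = proj (B ⧸ C) (mapU (QuotientGroup.mk' C) x) := by
  have h : (QuotientGroup.mk' C).comp (proj B) =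
      (proj (B ⧸ C)).comp (mapU (QuotientGroup.mk' C)) := by
    exact monoidHom_ext_u fun b => by simp
  exact DFunLike.congr_fun h x

theorem proj_mem_of_mem_URel {C : Subgroup B} [C.Normal] {v : U B} (hv : v ∈ URel C) :
    proj B v ∈ C := by
  rw [← QuotientGroup.eq_one_iff, ← QuotientGroup.mk'_apply, mk_proj,
    show mapU (QuotientGroup.mk' C) v = 1 from hv, map_one]

theorem mk_eq_one_of_mem_boundaries {C : Subgroup B} [C.Normal] {x : U B}
    (hx : x ∈ boundaries C) : (QuotientGroup.mk' (boundaries C)) x = 1 :=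
  (QuotientGroup.eq_one_iff _).2 hx

/-- Modulo boundaries, `⁅v, x⁆` depends only on the images of `v` and `x` in `B`. -/
theorem mk_commutator_congr {C : Subgroup B} [C.Normal]
    {v v' x x' : U B} (hv : v ∈ URel C) (hv' : v' ∈ URel C) (hvv : proj B v = proj B v')
    (hxx : proj B x = proj B x') :
    (QuotientGroup.mk' (boundaries C)) ⁅v, x⁆ = (QuotientGroup.mk' (boundaries C)) ⁅v', x'⁆ := by
  set q := QuotientGroup.mk' (boundaries C) with hq
  have hj : v'⁻¹ * v ∈ JRel C :=
    ⟨(URel C).mul_mem ((URel C).inv_mem hv') hv, by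
      change proj B _ = 1
      simp [hvv]⟩
  have hk : x'⁻¹ * x ∈ J B := by
    change proj B _ = 1
    simp [hxx]
  have h1 : Commute (q (v'⁻¹ * v)) (q x) := by
    rw [← commutatorElement_eq_one_iff_commute, ← map_commutatorElement]
    exact mk_eq_one_of_mem_boundaries (Subgroup.mem_sup_left
      (Subgroup.commutator_mem_commutator hj (Subgroup.mem_top _)))
  have h2 : Commute (q v') (q (x'⁻¹ * x)) := by
    rw [← commutatorElement_eq_one_iff_commute, ← map_commutatorElement]
    exact mk_eq_one_of_mem_boundaries (Subgroup.mem_sup_right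
      (Subgroup.commutator_mem_commutator hv' hk))
  have e1 : q v = q v' * q (v'⁻¹ * v) := by simp
  have e2 : q x = q x' * q (x'⁻¹ * x) := by simp
  calc q ⁅v, x⁆ = q v' * (q (v'⁻¹ * v) * q x * (q (v'⁻¹ * v))⁻¹) * (q v')⁻¹ * (q x)⁻¹ := by
        rw [map_commutatorElement, commutatorElement_def, e1]; group
    _ = q v' * q x * (q v')⁻¹ * (q x)⁻¹ := by rw [h1.eq, mul_inv_cancel_right]
    _ = q x' * (q x'⁻¹ * q v' * q x') * q (x'⁻¹ * x) * (q v')⁻¹ * (q x)⁻¹ := by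
        rw [e2]; simp [mul_assoc]
    _ = q v' * q x' * (q (x'⁻¹ * x) * (q v')⁻¹) * (q x)⁻¹ := by simp [mul_assoc]
    _ = q v' * q x' * ((q v')⁻¹ * q (x'⁻¹ * x)) * (q x)⁻¹ := by rw [h2.inv_left.eq]
    _ = q ⁅v', x'⁆ := by
        rw [map_commutatorElement, commutatorElement_def]; simp [mul_assoc]

/-- Two cycles agree in `K2` as soon as they agree modulo boundaries. -/
theorem K2_mk_eq {C : Subgroup B} [C.Normal] {x y : cycles C}
    (h : (QuotientGroup.mk' (boundaries C)) (x : U B) = (QuotientGroup.mk' (boundaries C)) y) :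
    (QuotientGroup.mk x : K2 C) = QuotientGroup.mk y :=
  QuotientGroup.eq.2 (Subgroup.mem_subgroupOf.2 (QuotientGroup.eq.1 h))

/-- A cycle that is a commutator modulo boundaries represents the corresponding symbol. -/
theorem mk_eq_symbol {C : Subgroup B} [C.Normal] (hC : C ≤ Subgroup.center B)
    (x : cycles C) {v y : U B} (hv : v ∈ URel C) (hx : (x : U B) = ⁅v, y⁆) :
    (QuotientGroup.mk x : K2 C) =
      symbol hC ⟨proj B v, proj_mem_of_mem_URel hv⟩ (proj B y) := by
  refine K2_mk_eq ?_
  rw [hx]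
  exact mk_commutator_congr hv (mem_URel_of_mem (proj_mem_of_mem_URel hv)) (by simp) (by simp)

theorem commutator_le_cycles {C : Subgroup B} [C.Normal] (hC : C ≤ Subgroup.center B) :
    ⁅URel C, (⊤ : Subgroup (U B))⁆ ≤ cycles C := by
  refine le_inf (le_inf (Subgroup.commutator_le_left _ _) ?_) le_rfl
  refine Subgroup.commutator_le.2 fun v hv x _ => ?_
  change proj B _ = 1
  rw [map_commutatorElement, commutatorElement_eq_one_iff_mul_comm]
  exact (Subgroup.mem_center_iff.1 (hC (proj_mem_of_mem_URel hv)) _).symm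

/-- Cycles lie in `JRel C`, so they are central modulo boundaries. This removes the conjugations
from the commutator identities below. -/
theorem mk_conj_cycle {C : Subgroup B} [C.Normal] {y : U B} (hy : y ∈ cycles C) (x : U B) :
    (QuotientGroup.mk' (boundaries C)) (x * y * x⁻¹) = (QuotientGroup.mk' (boundaries C)) y := by
  have h : ⁅y, x⁆ ∈ boundaries C := Subgroup.mem_sup_left
      (Subgroup.commutator_mem_commutator hy.1 (Subgroup.mem_top _))
  have h' := mk_eq_one_of_mem_boundaries h
  rw [map_commutatorElement, commutatorElement_eq_one_iff_mul_comm] at h'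
  rw [map_mul, map_mul, ← h', map_inv, mul_inv_cancel_right]

theorem symbol_mul_left {C : Subgroup B} [C.Normal] (hC : C ≤ Subgroup.center B)
    (c c' : C) (b : B) : symbol hC (c * c') b = symbol hC c b * symbol hC c' b := by
  -- The identity for `⁅a * a', b⁆` produces the factor of `a'` first.
  rw [mul_comm]
  refine K2_mk_eq ?_
  have h := mk_commutator_congr (x := u b) (x' := u b) (mem_URel_of_mem (c * c').2)
    (mul_mem (mem_URel_of_mem c.2) (mem_URel_of_mem c'.2)) (by simp) rfl
  rw [h, show ⁅u (c : B) * u (c' : B), u b⁆ =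
    (u (c : B) * ⁅u (c' : B), u b⁆ * (u (c : B))⁻¹) * ⁅u (c : B), u b⁆ by
      simp only [commutatorElement_def]; group, map_mul, mk_conj_cycle (commutator_mem_cycles hC _ _)]
  rfl

theorem symbol_mul_right {C : Subgroup B} [C.Normal] (hC : C ≤ Subgroup.center B)
    (c : C) (b b' : B) : symbol hC c (b * b') = symbol hC c b * symbol hC c b' := by
  refine K2_mk_eq ?_
  have h := mk_commutator_congr (v := u (c : B)) (v' := u (c : B)) (x := u (b * b'))
    (x' := u b * u b') (mem_URel_of_mem c.2) (mem_URel_of_mem c.2) rfl (by simp)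
  rw [h, show ⁅u (c : B), u b * u b'⁆ =
    ⁅u (c : B), u b⁆ * (u b * ⁅u (c : B), u b'⁆ * (u b)⁻¹) by
      simp only [commutatorElement_def]; group, map_mul, mk_conj_cycle (commutator_mem_cycles hC _ _)]
  rfl

theorem symbol_self {C : Subgroup B} [C.Normal] (hC : C ≤ Subgroup.center B) (c : C) :
    symbol hC c (c : B) = 1 := by
  refine (QuotientGroup.eq_one_iff _).2 ?_
  rw [Subgroup.mem_subgroupOf]
  simp

/-- The symbols generate `K2`. -/
theorem closure_symbol {C : Subgroup B} [C.Normal] (hC : C ≤ Subgroup.center B)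
    (H : Subgroup (K2 C)) (hH : ∀ c b, symbol hC c b ∈ H) : H = ⊤ := by
  have key : ⁅URel C, (⊤ : Subgroup (U B))⁆ ≤
      (H.comap (QuotientGroup.mk' _)).map (cycles C).subtype := by
    refine Subgroup.commutator_le.2 fun v hv x hx => ?_
    have hm := commutator_le_cycles hC (Subgroup.commutator_mem_commutator hv hx)
    refine ⟨⟨_, hm⟩, ?_, rfl⟩
    change (QuotientGroup.mk (⟨_, hm⟩ : cycles C) : K2 C) ∈ H
    rw [mk_eq_symbol hC ⟨_, hm⟩ hv rfl]
    exact hH _ _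
  rw [eq_top_iff]
  rintro a -
  obtain ⟨x, rfl⟩ := QuotientGroup.mk_surjective a
  obtain ⟨y, hy, hyx⟩ := key x.2.2
  rw [← Subtype.ext hyx]
  exact hy

/-! ### Homomorphisms out of `K2`. -/

/-- Splitting off a lift of `U_{B/C} → B/C`: every `x ∈ U_B` has projection
`κ x * ρ (image of x)` with `κ x ∈ C`. -/
theorem exists_factor_proj (C : Subgroup B) [C.Normal] (hC : C ≤ Subgroup.center B) :
    ∃ (κ : U B →* C) (ρ : U (B ⧸ C) →* B),
      ∀ x, proj B x = (κ x : B) * ρ (mapU (QuotientGroup.mk' C) x) := by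
  let ρ : U (B ⧸ C) →* B := FreeGroup.lift fun g => (g : B ⧸ C).out
  have hρ : ∀ y, (QuotientGroup.mk' C) (ρ y) = proj (B ⧸ C) y := by
    have : (QuotientGroup.mk' C).comp ρ = proj (B ⧸ C) := by
      ext g
      simp [ρ, proj]
    exact DFunLike.congr_fun this
  have hmem : ∀ b : B, b * (ρ (u (b : B ⧸ C)))⁻¹ ∈ C := fun b => by
    rw [← QuotientGroup.eq_one_iff, ← QuotientGroup.mk'_apply, map_mul, map_inv, hρ, proj_u]
    simp
  let κ : U B →* C := FreeGroup.lift fun g => ⟨_, hmem g⟩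
  have hκ : ∀ b, (κ (u b) : B) = b * (ρ (u (b : B ⧸ C)))⁻¹ := fun b => by
    by_cases h : b = 1
    · simp [h]
    · simp [u, h, κ]
  -- The product is a homomorphism because `κ` has central values, so comparison on the `u b`
  -- suffices.
  refine ⟨κ, ρ, DFunLike.congr_fun (F := U B →* B) (g := MonoidHom.mk'
    (fun x => (κ x : B) * ρ (mapU (QuotientGroup.mk' C) x)) fun x y => ?_)
    (monoidHom_ext_u fun b => ?_)⟩
  · have := Subgroup.mem_center_iff.1 (hC (κ y).2) (ρ (mapU (QuotientGroup.mk' C) x))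
    simp only [map_mul, Subgroup.coe_mul, mul_assoc]
    rw [← mul_assoc (ρ _) (κ y : B), this]
    simp only [mul_assoc]
  · simp [hκ]

/-- A biadditive map on `C × B^ab` that vanishes on the pairs `(c, c)` factors through `K2`. -/
theorem exists_hom_of_alternating {C : Subgroup B} [C.Normal] (hC : C ≤ Subgroup.center B)
    {A : Type*} [AddCommGroup A] :
    letI : CommGroup C := commGroupOfCentral hC
    ∀ t : Additive C →+ Additive (Abelianization B) →+ A,
      (∀ c : C, t (.ofMul c) (.ofMul (Abelianization.of (c : B))) = 0) →
      ∃ f : Additive (K2 C) →+ A, ∀ (c : C) (b : B),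
        f (.ofMul (symbol hC c b)) = t (.ofMul c) (.ofMul (Abelianization.of b)) := by
  let _ : CommGroup C := commGroupOfCentral hC
  intro t ht
  let inc : Additive C →+ Additive (Abelianization B) :=
    MonoidHom.toAdditive (Abelianization.of.comp C.subtype)
  obtain ⟨β, hβ⟩ := exists_sub_flip_eq (t.flip.comp inc).flip (fun c => ht c.toMul)
  let π : FreeAbelianGroup (Additive C) →+ Additive C := FreeAbelianGroup.lift id
  obtain ⟨κ, ρ, hκ⟩ := exists_factor_proj C hC
  -- `β` handles the `C`-part of the second argument, `t` the part coming from `ρ`.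
  let γ : FreeAbelianGroup (Additive C) × Additive (Abelianization B) →+
      FreeAbelianGroup (Additive C) × Additive (Abelianization B) →+ A :=
    AddMonoidHom.mk' (fun l => (β l.1).comp (AddMonoidHom.fst _ _) +
      (t (π l.1)).comp (AddMonoidHom.snd _ _)) fun l l' => by
        ext; simp [add_add_add_comm]
  have hγ : ∀ l l', γ l l' = β l.1 l'.1 + t (π l.1) l'.2 := fun _ _ => rfl
  let θ : U B →* Heis γ := FreeGroup.lift fun g =>
    ⟨(FreeAbelianGroup.of (.ofMul (κ (u (g : B)))),
      .ofMul (Abelianization.of (ρ (u ((g : B) : B ⧸ C))))), 0⟩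
  have hθ₁ : ∀ x, π (θ x).base.1 = .ofMul (κ x) := by
    have : (AddMonoidHom.toMultiplicative (π.comp (AddMonoidHom.fst _ _))).comp
        ((Heis.baseHom γ).comp θ) = MonoidHom.comp (MulEquiv.toMonoidHom
          (MulEquiv.multiplicativeAdditive C).symm) κ := by
      ext g
      simp [θ, Heis.baseHom, π, u, g.2]
    exact fun x => congrArg Multiplicative.toAdd (DFunLike.congr_fun this x)
  have hθ₂ : ∀ x, (θ x).base.2 =
      .ofMul (Abelianization.of (ρ (mapU (QuotientGroup.mk' C) x))) := by
    have : (AddMonoidHom.toMultiplicative (AddMonoidHom.snd _ _)).comp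
        ((Heis.baseHom γ).comp θ) = MonoidHom.comp (MulEquiv.toMonoidHom
          (MulEquiv.multiplicativeAdditive _).symm)
          (Abelianization.of.comp (ρ.comp (mapU (QuotientGroup.mk' C)))) := by
      ext g
      change (θ (FreeGroup.of g)).base.2.toMul =
        Abelianization.of (ρ (mapU (QuotientGroup.mk' C) (FreeGroup.of g)))
      simp [θ, mapU]
    exact fun x => congrArg Multiplicative.toAdd (DFunLike.congr_fun this x)
  -- The second base coordinate of `θ v` is zero. What remains is the antisymmetrized `β`, equal to
  -- `t(c, κ x)`, plus `t(c, ρ(x̄))` with `x̄` the image of `x` in `U (B ⧸ C)`; they add up to `t(c,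
  -- proj x)`.
  have hcomm : ∀ v ∈ URel C, ∀ x, ∀ c : C, proj B v = c →
      θ ⁅v, x⁆ = ⟨0, t (.ofMul c) (.ofMul (Abelianization.of (proj B x)))⟩ := by
    intro v hv x c hc
    have hv' : mapU (QuotientGroup.mk' C) v = 1 := hv
    have hcκ : κ v = c := by
      apply Subtype.ext
      rw [← hc, hκ v, hv', map_one, mul_one]
    have hinc : Additive.ofMul (Abelianization.of (proj B x)) =
        inc (.ofMul (κ x)) + .ofMul (Abelianization.of (ρ (mapU (QuotientGroup.mk' C) x))) := by
      rw [hκ x, map_mul]; rfl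
    rw [map_commutatorElement, Heis.commutator_eq]
    congr 1
    rw [hγ, hγ, hθ₂ v, hv', map_one, map_one, ofMul_one, map_zero, add_zero, add_sub_right_comm,
      hβ, hinc, map_add, ← hθ₁, ← hθ₂, ← hcκ, ← hθ₁ v]
    rfl
  have hbase : ∀ x ∈ cycles C, (θ x).base = 0 := by
    have : ⁅URel C, (⊤ : Subgroup (U B))⁆ ≤ ((Heis.baseHom γ).comp θ).ker :=
      Subgroup.commutator_le.2 fun v hv x _ => by
        rw [MonoidHom.mem_ker, MonoidHom.comp_apply, hcomm v hv x ⟨_, proj_mem_of_mem_URel hv⟩ rfl]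
        rfl
    exact fun x hx => congrArg Multiplicative.toAdd (this hx.2)
  have hbd : boundaries C ≤ θ.ker := by
    refine sup_le (Subgroup.commutator_le.2 fun v hv x _ => ?_)
      (Subgroup.commutator_le.2 fun v hv x hx => ?_)
    · rw [MonoidHom.mem_ker, hcomm v hv.1 x 1 hv.2, ofMul_one, map_zero]
      rfl
    · rw [MonoidHom.mem_ker, hcomm v hv x ⟨_, proj_mem_of_mem_URel hv⟩ rfl,
        show proj B x = 1 from hx, map_one, ofMul_one, map_zero]
      rfl
  -- The base vanishes on cycles, so the cocycle term does too and the fibre coordinate is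
  -- multiplicative.
  let f₀ : cycles C →* Multiplicative A := MonoidHom.mk'
    (fun x => .ofAdd (θ x).fib) fun x y => by
      rw [Subgroup.coe_mul, map_mul, Heis.mul_fib, hbase x x.2, map_zero,
        AddMonoidHom.zero_apply, add_zero, ofAdd_add]
  let f₁ : K2 C →* Multiplicative A := QuotientGroup.lift _ f₀ fun x hx => by
    have : θ x = 1 := hbd (Subgroup.mem_subgroupOf.1 hx)
    change Multiplicative.ofAdd (θ x).fib = 1
    rw [this]; rfl
  refine ⟨MonoidHom.toAdditiveLeft f₁, fun c b => ?_⟩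
  change (θ ⁅u (c : B), u b⁆).fib = _
  rw [hcomm _ (mem_URel_of_mem c.2) _ c (proj_u _), proj_u]

/-- The surjection `C ⊗ B^ab → K2`, `c ⊗ b ↦ [u_c, u_b]`. -/
theorem exists_tensor_hom {C : Subgroup B} [C.Normal] (hC : C ≤ Subgroup.center B) :
    letI : CommGroup C := commGroupOfCentral hC
    ∃ φ : Additive C ⊗[ℤ] Additive (Abelianization B) →+ Additive (K2 C),
      (∀ (c : C) (b : B), φ (Additive.ofMul c ⊗ₜ[ℤ] Additive.ofMul (Abelianization.of b)) =
          Additive.ofMul (symbol hC c b)) ∧ Function.Surjective φ := by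
  let _ : CommGroup C := commGroupOfCentral hC
  let s : Additive C →+ Additive (Abelianization B) →+ Additive (K2 C) :=
    AddMonoidHom.mk' (fun c => MonoidHom.toAdditive (Abelianization.lift
      (MonoidHom.mk' (fun b => symbol hC c.toMul b) (symbol_mul_right hC c.toMul))))
      fun c c' => by
        ext b
        exact symbol_mul_left hC c.toMul c'.toMul b
  have hφ : ∀ (c : C) (b : B), TensorProduct.liftAddHom s (fun n c x => by simp)
      (Additive.ofMul c ⊗ₜ[ℤ] Additive.ofMul (Abelianization.of b)) =
        Additive.ofMul (symbol hC c b) := fun _ _ => rfl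
  refine ⟨_, hφ, ?_⟩
  rw [← AddMonoidHom.range_eq_top, eq_top_iff]
  rintro a -
  have h := closure_symbol hC (AddSubgroup.toSubgroup' (TensorProduct.liftAddHom s
    (fun n c x => by simp)).range) (fun c b => ⟨_, hφ c b⟩)
  have : a.toMul ∈ (⊤ : Subgroup (K2 C)) := trivial
  rw [← h] at this
  exact this

end KJ

theorem lemma17 {B : Type*} [Group B] (C : Subgroup B) (hC : C ≤ Subgroup.center B) :
    haveI : C.Normal := KJ.normal_of_central hC
    letI : CommGroup C := KJ.commGroupOfCentral hC
    -- the surjection `C ⊗ B^ab → K^J_2(C, B)` and its kernel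
    (∃ φ : Additive C ⊗[ℤ] Additive (Abelianization B) →+ Additive (KJ.K2 C),
      (∀ (c : C) (b : B),
        φ (Additive.ofMul c ⊗ₜ[ℤ] Additive.ofMul (Abelianization.of b)) =
          Additive.ofMul (KJ.symbol hC c b)) ∧
      Function.Surjective φ ∧
      φ.ker = AddSubgroup.closure (Set.range fun c : C =>
        Additive.ofMul c ⊗ₜ[ℤ] Additive.ofMul (Abelianization.of (c : B)))) ∧
    -- the surjection `K^J_2(C, B) → C ⊗ (B/C)^ab`
    (∃ ψ : Additive (KJ.K2 C) →+ Additive C ⊗[ℤ] Additive (Abelianization (B ⧸ C)),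
      (∀ (c : C) (b : B),
        ψ (Additive.ofMul (KJ.symbol hC c b)) =
          Additive.ofMul c ⊗ₜ[ℤ] Additive.ofMul (Abelianization.of (b : B ⧸ C))) ∧
      Function.Surjective ψ) := by
  have : C.Normal := KJ.normal_of_central hC
  let _ : CommGroup C := KJ.commGroupOfCentral hC
  obtain ⟨φ, hφ, hsurj⟩ := KJ.exists_tensor_hom hC
  set R := AddSubgroup.closure (Set.range fun c : C =>
    (Additive.ofMul c ⊗ₜ[ℤ] Additive.ofMul (Abelianization.of (c : B)) :
      Additive C ⊗[ℤ] Additive (Abelianization B)))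
  let t : Additive C →+ Additive (Abelianization B) →+
      (Additive C ⊗[ℤ] Additive (Abelianization B)) ⧸ R :=
    AddMonoidHom.mk' (fun c => (QuotientAddGroup.mk' R).comp
      (TensorProduct.mk ℤ _ _ c).toAddMonoidHom) fun c c' => by ext; simp
  obtain ⟨f, hf⟩ := KJ.exists_hom_of_alternating hC t fun c =>
    (QuotientAddGroup.eq_zero_iff _).2 (AddSubgroup.subset_closure ⟨c, rfl⟩)
  -- This forces `φ.ker ≤ R`; the reverse inclusion is `symbol_self`.
  have hfφ : f.comp φ = QuotientAddGroup.mk' R := by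
    ext x
    induction x using TensorProduct.induction_on with
    | zero => simp only [map_zero]
    | add x y hx hy => rw [map_add, map_add, hx, hy]
    | tmul c x =>
      obtain ⟨b, hb⟩ := KJ.abelianization_of_surjective _ x.toMul
      obtain rfl : Additive.ofMul (Abelianization.of b) = x := hb
      exact (congrArg f (hφ c.toMul b)).trans (hf c.toMul b)
  have hker : φ.ker = R := by
    refine le_antisymm (fun x hx => ?_) ((AddSubgroup.closure_le _).2 ?_)
    · rw [← QuotientAddGroup.eq_zero_iff, ← QuotientAddGroup.mk'_apply, ← hfφ,
        AddMonoidHom.comp_apply, show φ x = 0 from hx, map_zero]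
    · rintro _ ⟨c, rfl⟩
      change φ _ = 0
      rw [hφ, KJ.symbol_self, ofMul_one]
  refine ⟨⟨φ, hφ, hsurj, hker⟩, ?_⟩
  let t' : Additive C →+ Additive (Abelianization B) →+
      Additive C ⊗[ℤ] Additive (Abelianization (B ⧸ C)) :=
    AddMonoidHom.mk' (fun c => (TensorProduct.mk ℤ _ _ c).toAddMonoidHom.comp
      (MonoidHom.toAdditive (Abelianization.map (QuotientGroup.mk' C))))
      fun c c' => by ext; simp
  have ht' : ∀ (c : C) (b : B), t' (.ofMul c) (.ofMul (Abelianization.of b)) =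
      Additive.ofMul c ⊗ₜ[ℤ] Additive.ofMul (Abelianization.of (b : B ⧸ C)) := fun _ _ => rfl
  -- The condition on `(c, c)` holds because `c` dies in `B ⧸ C`.
  obtain ⟨ψ, hψ⟩ := KJ.exists_hom_of_alternating hC t' fun c => by
    rw [ht', (QuotientGroup.eq_one_iff (c : B)).2 c.2, map_one, ofMul_one, TensorProduct.tmul_zero]
  refine ⟨ψ, fun c b => (hψ c b).trans (ht' c b), fun y => ?_⟩
  rw [← AddMonoidHom.mem_range]
  induction y using TensorProduct.induction_on with
  | zero => exact zero_mem _
  | add x y hx hy => exact add_mem hx hy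
  | tmul c x =>
    obtain ⟨q, hq⟩ := KJ.abelianization_of_surjective _ x.toMul
    obtain ⟨b, rfl⟩ := QuotientGroup.mk_surjective q
    obtain rfl : Additive.ofMul (Abelianization.of (b : B ⧸ C)) = x := hq
    exact ⟨_, (hψ c.toMul b).trans (ht' c.toMul b)⟩
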